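/- Let $s\ge 2$ and $d\ge 2$ be integers and let $G$ be a fixed finite $s$-uniform hypergraph (a finite vertex set together with a set of $s$-element subsets of it, the edges) of degeneracy $d$. Here the degeneracy of $G$ is the smallest integer $k\ge 0$ such that every sub-hypergraph of $G$ with at least one vertex has a vertex contained in at most $k$ of its edges. For $n\ge s-1$, consider the following process on the vertex set $[n]=\{1,\dots,n\}$. It starts from the hypergraph $H_0^{(1,s)}$ with no edges. In each round $i\ge 1$ a vertex $u_i\in[n]$ is chosen uniformly at random, independently of the past; then the player selects a set $V_i\subseteq [n]$ of $s-1$ vertices, and the edge $\{u_i\}\cup V_i$, taken as a multiset of size $s$, is added to $H_{i-1}^{(1,s)}$ to form $H_i^{(1,s)}$. (Parallel edges are allowed, and so is $u_i\in V_i$.) A strategy $\mathcal S$ specifies, for each such $n$ and each $i\ge1$, a probability distribution, depending on $u_1,V_1,\dots,u_{i-1},V_{i-1},u_i$, according to which $V_i$ is chosen. Write $G\subseteq H$ if there is an injective map from the vertices of $G$ to the vertices of $H$ that sends every edge of $G$ onto an edge of $H$. Then for every strategy $\mathcal S$ and every function $\omega=\omega(n)$ tending to infinity as $n\to\infty$,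 $$\lim_{n\to\infty}\mathbb P\bigl[G\subseteq H_t^{(1,s)}\bigr]=0,\qquad\text{where } t=\Bigl\lfloor \frac{n^{(d-1)/d}}{\omega(n)}\Bigr\rfloor .$$ -/

import Mathlib

open Filter Topology

namespace SemiRandom

section Degeneracy

variable {α : Type*}

/-- Every edge has exactly `s` vertices. -/
def IsUniform (G : Hypergraph α) (s : ℕ) : Prop :=
  ∀ e ∈ G.edgeSet, e.ncard = s

/-- `G'` is a sub-hypergraph of `G` (not necessarily induced). -/
def IsSub (G' G : Hypergraph α) : Prop :=
  G'.vertexSet ⊆ G.vertexSet ∧ G'.edgeSet ⊆ G.edgeSet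

/-- The number of edges of `G` containing `v`. -/
noncomputable def degree (G : Hypergraph α) (v : α) : ℕ :=
  {e | e ∈ G.edgeSet ∧ v ∈ e}.ncard

/-- The minimum degree over the vertices of `G` (equal to `0` if `G` has no vertex). -/
noncomputable def minDegree (G : Hypergraph α) : ℕ :=
  sInf (degree G '' G.vertexSet)

/-- Every sub-hypergraph has minimum degree at most `d`. -/
def IsDegenerate (G : Hypergraph α) (d : ℕ) : Prop :=
  ∀ G' : Hypergraph α, IsSub G' G → minDegree G' ≤ d

/-- The smallest `d` for which `G` is `d`-degenerate. -/
noncomputable def degeneracy (G : Hypergraph α) : ℕ :=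
  sInf {d | IsDegenerate G d}

end Degeneracy

section Game

/-- The possible answers of the player: sets of `s - 1` vertices of `[n]`. -/
abbrev Choice (n s : ℕ) : Type :=
  {A : Finset (Fin n) // A.card = s - 1}

/-- The history of the process: in chronological order, for each round, the vertex presented to the
player and the set chosen by the player. -/
abbrev History (n s : ℕ) : Type :=
  List (Fin n × Choice n s)

/-- A (possibly randomised) strategy on `[n]`: given the history of the previous rounds and the
vertex presented in the current round, a distribution over the possible answers. -/
abbrev Strategy (n s : ℕ) : Type :=
  History n s → Fin n → PMF (Choice n s)

/-- The uniform distribution on `[n]`. -/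
noncomputable def uniformVertex (n : ℕ) (hn : 0 < n) : PMF (Fin n) :=
  PMF.uniformOfFinset Finset.univ ⟨⟨0, hn⟩, Finset.mem_univ _⟩

/-- The law of the history after `t` rounds, when the player follows the strategy `S`. -/
noncomputable def historyLaw {n s : ℕ} (hn : 0 < n) (S : Strategy n s) : ℕ → PMF (History n s)
  | 0 => PMF.pure []
  | t + 1 => (historyLaw hn S t).bind fun h =>
      (uniformVertex n hn).bind fun u =>
        (S h u).map fun A => h ++ [(u, A)]

/-- The `s`-uniform multi-hypergraph on `[n]` built along a history: each round `(u, A)` adds the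
edge `{u} ∪ A`, as a multiset (so `u` has multiplicity two if `u ∈ A`). Parallel edges are kept. -/
def builtEdges {n s : ℕ} (h : History n s) : Multiset (Multiset (Fin n)) :=
  ↑(h.map fun p => p.1 ::ₘ p.2.1.val)

/-- The law of the random multi-hypergraph obtained after `t` rounds. -/
noncomputable def hypergraphLaw {n s : ℕ} (hn : 0 < n) (S : Strategy n s) (t : ℕ) :
    PMF (Multiset (Multiset (Fin n))) :=
  (historyLaw hn S t).map builtEdges

/-- The multi-hypergraph on `[n]` with edges `H` contains a copy of `G`. -/
def ContainsCopy {α : Type*} {n : ℕ} (G : Hypergraph α) (H : Multiset (Multiset (Fin n))) : Prop :=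
  ∃ φ : α → Fin n, Set.InjOn φ G.vertexSet ∧
    ∀ e ∈ G.edgeSet, ∃ f ∈ H, f.Nodup ∧ {x | x ∈ f} = φ '' e

/-- The probability that the multi-hypergraph built in `t` rounds contains a copy of `G`. -/
noncomputable def copyProb {α : Type*} {n s : ℕ} (hn : 0 < n) (S : Strategy n s)
    (G : Hypergraph α) (t : ℕ) : ENNReal :=
  (hypergraphLaw hn S t).toOuterMeasure {H | ContainsCopy G H}

end Game

end SemiRandom

/-! Write the degeneracy as `d + 1` and orient each round from its presented vertex to the chosen
ones. A copy contains a sub-hypergraph of minimum degree at least `d + 1`; peeling off its rounds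
from the latest backwards shows that its vertices reach level `d + 1` (`mem_level_of_incidence`), so
some round presents a vertex of level `d` (`hits_ne_nil_of_containsCopy`). The player cannot
influence whether the next presented vertex lies on a given level. Until level `d` is hit,
out-degrees are bounded, so level `k + 1` has at most `C` times as many vertices as there were hits
on level `k` (`card_level_succ_le`). Over `t` rounds each further level thus costs a factor `C * t /
n`, and level `d` is hit with probability at most `(C / n) ^ d * t ^ (d + 1)`, which is at most `C ^
d / ω ^ (d + 1)` for the given `t`. -/

namespace SemiRandom

/-! ### Levels and reachability along a fixed history -/

section Reachability

variable {n s : ℕ}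

/-- The vertices chosen by the player in the rounds of `r` where `a` was presented. -/
def outNeighbors (r : History n s) (a : Fin n) : Finset (Fin n) :=
  (r.filter fun p => p.1 = a).toFinset.biUnion fun p => p.2.1

/-- The vertices reachable from `a` in at most `L` steps from a presented vertex to a vertex chosen
in the same round. -/
def reach (r : History n s) : ℕ → Fin n → Finset (Fin n)
  | 0, a => {a}
  | L + 1, a => {a} ∪ (outNeighbors r a).biUnion (reach r L)

/-- One step from the presented vertex to a vertex chosen in the same round. -/
def Step (F : History n s) (a b : Fin n) : Prop :=
  ∃ p ∈ F, p.1 = a ∧ b ∈ p.2.1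

/-- The number of rounds whose edge contains `y`. -/
def incidence (F : History n s) (y : Fin n) : ℕ :=
  F.countP fun p => y = p.1 ∨ y ∈ p.2.1

/-- The vertices presented in the rounds at whose start they belonged to the set `P`. Histories are
listed here with the latest round first. -/
def hits (P : History n s → Finset (Fin n)) : History n s → List (Fin n)
  | [] => []
  | q :: r => if q.1 ∈ P r then q.1 :: hits P r else hits P r

/-- Level `0` is everything, and level `k + 1` consists of the vertices reachable in at most `L`
steps from a vertex that was presented while on level `k`. -/
def level (L : ℕ) : ℕ → History n s → Finset (Fin n)
  | 0, _ => Finset.univ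
  | k + 1, r => (hits (level L k) r).toFinset.biUnion (reach r L)

theorem mem_outNeighbors {r : History n s} {a b : Fin n} :
    b ∈ outNeighbors r a ↔ Step r a b := by
  simp only [outNeighbors, Step, Finset.mem_biUnion, List.mem_toFinset, List.mem_filter,
    decide_eq_true_eq, and_assoc]

theorem Step.mono {F r : History n s} (h : F ⊆ r) {a b : Fin n} (hab : Step F a b) :
    Step r a b := by
  obtain ⟨p, hp, h1, h2⟩ := hab
  exact ⟨p, h hp, h1, h2⟩

theorem self_mem_reach (r : History n s) (L : ℕ) (a : Fin n) : a ∈ reach r L a := by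
  cases L <;> simp [reach]

theorem reach_mono_length {r : History n s} {L M : ℕ} (h : L ≤ M) (a : Fin n) :
    reach r L a ⊆ reach r M a := by
  induction M generalizing L a with
  | zero => obtain rfl : L = 0 := by omega
            exact subset_rfl
  | succ M ih =>
    cases L with
    | zero => simp [reach]
    | succ L =>
      simp only [reach]
      exact Finset.union_subset_union_right
        (Finset.biUnion_mono fun b _ => ih (by omega) b)

theorem reach_mono_history {F r : History n s} (h : F ⊆ r) (L : ℕ) (a : Fin n) :
    reach F L a ⊆ reach r L a := by
  induction L generalizing a with
  | zero => exact subset_rfl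
  | succ L ih =>
    simp only [reach]
    refine Finset.union_subset_union_right fun x hx => ?_
    simp only [Finset.mem_biUnion, mem_outNeighbors] at hx ⊢
    obtain ⟨b, hb, hx⟩ := hx
    exact ⟨b, hb.mono h, ih b hx⟩

theorem reflTransGen_avoiding_start {β : Type*} {R : β → β → Prop} {b x : β}
    (h : Relation.ReflTransGen R b x) :
    Relation.ReflTransGen (fun y z => R y z ∧ z ≠ b) b x := by
  induction h with
  | refl => exact .refl
  | @tail y z _ hyz ih =>
    by_cases hz : z = b
    · subst hz; exact .refl
    · exact ih.tail ⟨hyz, hz⟩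

/-- After the first step to `b`, the walk may be restarted at its last visit to `b`, so `b` can be
erased from `W`. -/
theorem mem_reach_of_reflTransGen {r : History n s} {R : Fin n → Fin n → Prop}
    (hR : ∀ y z, R y z → Step r y z) (W : Finset (Fin n)) (hW : ∀ y z, R y z → z ∈ W)
    {a x : Fin n} (h : Relation.ReflTransGen R a x) : x ∈ reach r W.card a := by
  induction hc : W.card generalizing W R a with
  | zero =>
    rcases h.cases_head with rfl | ⟨b, hab, _⟩
    · exact self_mem_reach _ _ _
    · rw [Finset.card_eq_zero] at hc
      simpa [hc] using hW _ _ hab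
  | succ m ih =>
    rcases h.cases_head with rfl | ⟨b, hab, hbx⟩
    · exact self_mem_reach _ _ _
    · have hb := hW _ _ hab
      have := ih (R := fun y z => R y z ∧ z ≠ b) (fun y z h => hR y z h.1) (W.erase b)
        (fun y z h => Finset.mem_erase.2 ⟨h.2, hW y z h.1⟩) (reflTransGen_avoiding_start hbx)
        (by rw [Finset.card_erase_of_mem hb, hc]; rfl)
      simp only [reach, Finset.mem_union, Finset.mem_biUnion, mem_outNeighbors]
      exact Or.inr ⟨b, hR _ _ hab, this⟩

theorem hits_subset_cons (P : History n s → Finset (Fin n)) (q : Fin n × Choice n s)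
    (r : History n s) : hits P r ⊆ hits P (q :: r) := by
  simp only [hits]
  split_ifs
  · exact List.subset_cons_self _ _
  · exact List.Subset.refl _

theorem level_subset_cons (L k : ℕ) (q : Fin n × Choice n s) (r : History n s) :
    level L k r ⊆ level L k (q :: r) := by
  cases k with
  | zero => exact subset_rfl
  | succ k =>
    intro x hx
    simp only [level, Finset.mem_biUnion, List.mem_toFinset] at hx ⊢
    obtain ⟨a, ha, hx⟩ := hx
    exact ⟨a, hits_subset_cons _ _ _ ha, reach_mono_history (List.subset_cons_self _ _) _ _ hx⟩

theorem mem_level_succ_cons {L k : ℕ} {q : Fin n × Choice n s} {r : History n s} {x : Fin n}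
    (hq : q.1 ∈ level L k r) (hx : x ∈ reach (q :: r) L q.1) : x ∈ level L (k + 1) (q :: r) := by
  simp only [level, Finset.mem_biUnion, List.mem_toFinset]
  exact ⟨q.1, by simp [hits, hq], hx⟩

/-- Being presented while on level `k` puts a vertex on level `k + 1`, as it reaches itself in zero
steps. -/
theorem mem_level_of_le_count (L k : ℕ) (r : History n s) (a : Fin n)
    (h : k ≤ r.countP fun p => p.1 = a) : a ∈ level L k r := by
  induction r generalizing k with
  | nil =>
    obtain rfl : k = 0 := by simpa using h
    simp [level]
  | cons q r ih =>
    cases k with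
    | zero => simp [level]
    | succ k =>
      rw [List.countP_cons] at h
      by_cases hq : q.1 = a
      · subst hq
        simp only [decide_true, if_true] at h
        exact mem_level_succ_cons (ih k (by omega)) (self_mem_reach _ _ _)
      · simp only [hq, decide_false, Bool.false_eq_true, if_false] at h
        exact level_subset_cons _ _ _ _ (ih _ (by omega))

/-- If every vertex leading to `x` within the rounds `F` lies in at least `k` of their edges, then
`x` has reached level `k`. -/
theorem mem_level_of_incidence {L : ℕ} (W : Finset (Fin n)) (hWL : W.card ≤ L) (k : ℕ)
    {F r : History n s} (hF : F.Sublist r) (hFW : ∀ p ∈ F, p.2.1 ⊆ W) (x : Fin n)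
    (hx : ∀ y, Relation.ReflTransGen (Step F) y x → k ≤ incidence F y) : x ∈ level L k r := by
  induction k generalizing F r x with
  | zero => simp [level]
  | succ k ihk =>
    induction hF with
    | slnil => simpa [incidence] using hx x .refl
    | cons q _ ih => exact level_subset_cons _ _ _ _ (ih hFW hx)
    | @cons_cons F r q hF ih =>
      have hmono : ∀ {y}, Relation.ReflTransGen (Step F) y x →
          Relation.ReflTransGen (Step (q :: F)) y x := fun h =>
        Relation.ReflTransGen.mono (fun _ _ => Step.mono (List.subset_cons_self _ _)) _ _ h
      have hFW' : ∀ p ∈ F, p.2.1 ⊆ W := fun p hp => hFW p (List.mem_cons_of_mem _ hp)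
      -- If the latest round `q` of `F` leads to `x`, then whatever leads to `q.1` also leads to
      -- `x`. Dropping `q` costs each incidence at most one, so `q.1` was already on level `k` and
      -- presenting it lifts `x`.
      by_cases hq : Relation.ReflTransGen (Step (q :: F)) q.1 x
      · refine mem_level_succ_cons (ihk hF hFW' q.1 fun y hy => ?_) ?_
        · have := hx y ((Relation.ReflTransGen.mono
            (fun _ _ => Step.mono (List.subset_cons_self _ _)) _ _ hy).trans hq)
          rw [incidence, List.countP_cons] at this
          rw [incidence]
          split_ifs at this <;> omega
        · refine reach_mono_length hWL _ (mem_reach_of_reflTransGen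
            (fun y z h => h.mono ((List.Sublist.cons_cons q hF).subset)) W ?_ hq)
          rintro y z ⟨p, hp, -, hz⟩
          exact hFW p hp hz
      -- Otherwise no vertex leading to `x` lies in the edge of `q`, so dropping `q` changes none of
      -- the relevant incidences.
      · refine level_subset_cons _ _ _ _ (ih hFW' fun y hy => ?_)
        have := hx y (hmono hy)
        rw [incidence, List.countP_cons, if_neg] at this
        · exact this
        · simp only [decide_eq_true_eq]
          rintro (rfl | h)
          · exact hq (hmono hy)
          · exact hq (.head ⟨q, by simp, rfl, h⟩ (hmono hy))

/-- A bound for the number of vertices reachable in `L` steps when out-degrees are at most `D`. -/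
def reachBound (D : ℕ) : ℕ → ℕ
  | 0 => 1
  | L + 1 => 1 + D * reachBound D L

theorem card_reach_le {r : History n s} {D : ℕ} (hD : ∀ b, (outNeighbors r b).card ≤ D)
    (L : ℕ) (a : Fin n) : (reach r L a).card ≤ reachBound D L := by
  induction L generalizing a with
  | zero => simp [reach, reachBound]
  | succ L ih =>
    simp only [reach, reachBound]
    refine (Finset.card_union_le _ _).trans (Nat.add_le_add (by simp) ?_)
    exact (Finset.card_biUnion_le_card_mul _ _ _ fun b _ => ih b).trans
      (Nat.mul_le_mul_right _ (hD a))

theorem card_outNeighbors_le (r : History n s) (a : Fin n) :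
    (outNeighbors r a).card ≤ (r.countP fun p => p.1 = a) * (s - 1) := by
  refine (Finset.card_biUnion_le_card_mul _ _ (s - 1) fun p _ => p.2.2.le).trans ?_
  refine Nat.mul_le_mul_right _ ?_
  rw [List.countP_eq_length_filter]
  exact List.toFinset_card_le _

/-- A vertex presented `d + 1` times would be on level `d + 1`, which is empty as long as level `d`
is not hit. Hence out-degrees are at most `d * (s - 1)`. -/
theorem card_level_succ_le {L d : ℕ} {r : History n s} (h : hits (level L d) r = []) (k : ℕ) :
    (level L (k + 1) r).card ≤ (hits (level L k) r).length * reachBound (d * (s - 1)) L := by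
  have hcount : ∀ a, (r.countP fun p => p.1 = a) ≤ d := by
    intro a
    by_contra! hlt
    have := mem_level_of_le_count L (d + 1) r a hlt
    simp [level, h] at this
  refine (Finset.card_biUnion_le_card_mul _ _ _ fun a _ => card_reach_le (fun b =>
    (card_outNeighbors_le r b).trans (Nat.mul_le_mul_right _ (hcount b))) L a).trans ?_
  exact Nat.mul_le_mul_right _ (List.toFinset_card_le _)

end Reachability

/-! ### Copies force a hit on level `d` -/

section Copies

variable {α : Type*}

theorem exists_sub_le_degree {G : Hypergraph α} {d : ℕ} (h : degeneracy G = d + 1) :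
    ∃ G' : Hypergraph α, IsSub G' G ∧ G'.vertexSet.Nonempty ∧
      ∀ v ∈ G'.vertexSet, d + 1 ≤ degree G' v := by
  have hd : ¬ IsDegenerate G d := by
    have := Nat.notMem_of_lt_sInf (s := {d | IsDegenerate G d}) (m := d)
      (by rw [← degeneracy, h]; omega)
    exact this
  simp only [IsDegenerate, not_forall, not_le] at hd
  obtain ⟨G', hG', hlt⟩ := hd
  refine ⟨G', hG', ?_, fun v hv => (Nat.succ_le_of_lt hlt).trans (Nat.sInf_le ⟨v, hv, rfl⟩)⟩
  -- Without vertices, `minDegree` is `sInf ∅ = 0`, which cannot exceed `d`.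
  by_contra hne
  rw [Set.not_nonempty_iff_eq_empty] at hne
  simp [minDegree, hne] at hlt

/-- A history containing a copy of a hypergraph of degeneracy `d + 1` has a round whose presented
vertex was on level `d`. -/
theorem hits_ne_nil_of_containsCopy {n s d : ℕ} {G : Hypergraph α} (hfin : G.vertexSet.Finite)
    (hdeg : degeneracy G = d + 1) {r : History n s} (hc : ContainsCopy G (builtEdges r)) :
    hits (level G.vertexSet.ncard d) r ≠ [] := by
  classical
  obtain ⟨G', ⟨hV, hE⟩, ⟨v, hv⟩, hmin⟩ := exists_sub_le_degree hdeg
  obtain ⟨φ, hφ, hcopy⟩ := hc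
  have hfin' := hfin.subset hV
  set edge : Fin n × Choice n s → Set (Fin n) := fun p => {x | x = p.1 ∨ x ∈ p.2.1}
  set F : History n s := r.filter fun p => ∃ e ∈ G'.edgeSet, edge p = φ '' e with hFdef
  have hround : ∀ e ∈ G'.edgeSet, ∃ p ∈ F, edge p = φ '' e := by
    intro e he
    obtain ⟨f, hf, -, hfe⟩ := hcopy e (hE he)
    simp only [builtEdges, Multiset.mem_coe, List.mem_map] at hf
    obtain ⟨p, hp, rfl⟩ := hf
    have hpe : edge p = φ '' e := by
      rw [← hfe]; ext x; simp [edge]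
    exact ⟨p, by simp only [hFdef, List.mem_filter, decide_eq_true_eq]; exact ⟨hp, e, he, hpe⟩, hpe⟩
  have hFedge : ∀ p ∈ F, edge p ⊆ φ '' G'.vertexSet := by
    intro p hp
    simp only [hFdef, List.mem_filter, decide_eq_true_eq] at hp
    obtain ⟨-, e, he, hpe⟩ := hp
    rw [hpe]
    exact Set.image_mono (G'.subset_vertexSet_of_mem_edgeSet' he)
  have hinc : ∀ w ∈ G'.vertexSet, d + 1 ≤ incidence F (φ w) := by
    intro w hw
    refine (hmin w hw).trans ?_
    have hne : Nonempty (Fin n × Choice n s) := by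
      obtain ⟨e, he, -⟩ := Set.nonempty_of_ncard_ne_zero
        (Nat.ne_of_gt ((Nat.succ_pos d).trans_le (hmin w hw)))
      exact ⟨(hround e he).choose⟩
    choose! p hpF hpe using hround
    set T := (F.filter fun p => φ w = p.1 ∨ φ w ∈ p.2.1).toFinset with hT
    have hTF : T.card ≤ incidence F (φ w) := by
      rw [incidence, List.countP_eq_length_filter]
      exact List.toFinset_card_le _
    refine le_trans ?_ hTF
    rw [degree, ← Set.ncard_coe_finset]
    refine Set.ncard_le_ncard_of_injOn p ?_ ?_ (Finset.finite_toSet T)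
    · rintro e ⟨he, hwe⟩
      have : φ w ∈ edge (p e) := by rw [hpe e he]; exact ⟨w, hwe, rfl⟩
      simp only [hT, Finset.mem_coe, List.mem_toFinset, List.mem_filter, decide_eq_true_eq]
      exact ⟨hpF e he, this⟩
    -- Distinct edges have distinct images under the injective `φ`, hence are realised by distinct
    -- rounds.
    · rintro e ⟨he, -⟩ e' ⟨he', -⟩ hee
      refine (hφ.image_eq_image_iff ?_ ?_).1 ?_
      · exact (G'.subset_vertexSet_of_mem_edgeSet' he).trans hV
      · exact (G'.subset_vertexSet_of_mem_edgeSet' he').trans hV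
      · rw [← hpe e he, ← hpe e' he', hee]
  have hlev : φ v ∈ level G.vertexSet.ncard (d + 1) r := by
    refine mem_level_of_incidence (hfin'.image φ).toFinset ?_ (d + 1) (F := F)
      List.filter_sublist ?_ (φ v) ?_
    · rw [← Set.ncard_eq_toFinset_card]
      exact (Set.ncard_image_le hfin').trans (Set.ncard_le_ncard hV hfin)
    · intro p hp x hx
      rw [Set.Finite.mem_toFinset]
      exact hFedge p hp (Or.inr hx)
    · intro y hy
      have : y ∈ φ '' G'.vertexSet := by
        rcases hy.cases_head with rfl | ⟨b, ⟨p, hp, rfl, -⟩, -⟩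
        · exact ⟨v, hv, rfl⟩
        · exact hFedge p hp (Or.inl rfl)
      obtain ⟨w, hw, rfl⟩ := this
      exact hinc w hw
  intro h
  simp [level, h] at hlev

end Copies

/-! ### Expectations in `ENNReal` -/

section Expectation

/-- The expectation of `f` under `p`. -/
noncomputable def mean {β : Type*} (p : PMF β) (f : β → ENNReal) : ENNReal :=
  ∑' b, p b * f b

theorem mean_mono {β : Type*} (p : PMF β) {f g : β → ENNReal} (h : ∀ b, f b ≤ g b) :
    mean p f ≤ mean p g :=
  ENNReal.tsum_le_tsum fun b => mul_le_mul_right (h b) _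

theorem mean_add {β : Type*} (p : PMF β) (f g : β → ENNReal) :
    mean p (fun b => f b + g b) = mean p f + mean p g := by
  simp only [mean, mul_add, ENNReal.tsum_add]

theorem mean_const_mul {β : Type*} (p : PMF β) (c : ENNReal) (f : β → ENNReal) :
    mean p (fun b => c * f b) = c * mean p f := by
  simp only [mean, ← ENNReal.tsum_mul_left]
  exact tsum_congr fun b => mul_left_comm _ _ _

theorem mean_const {β : Type*} (p : PMF β) (c : ENNReal) : mean p (fun _ => c) = c := by
  simp [mean, ENNReal.tsum_mul_right, p.tsum_coe]

theorem mean_pure {β : Type*} (a : β) (f : β → ENNReal) : mean (PMF.pure a) f = f a := by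
  classical
  simp only [mean, PMF.pure_apply, ite_mul, one_mul, zero_mul]
  exact tsum_ite_eq a _

theorem mean_bind {β γ : Type*} (p : PMF β) (q : β → PMF γ) (f : γ → ENNReal) :
    mean (p.bind q) f = mean p fun b => mean (q b) f := by
  simp only [mean, PMF.bind_apply, ← ENNReal.tsum_mul_right, ← ENNReal.tsum_mul_left]
  rw [ENNReal.tsum_comm]
  simp only [mul_assoc]

theorem mean_map {β γ : Type*} (p : PMF β) (g : β → γ) (f : γ → ENNReal) :
    mean (p.map g) f = mean p fun b => f (g b) := by
  rw [← PMF.bind_pure_comp, mean_bind]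
  simp only [Function.comp, mean_pure]

theorem toOuterMeasure_eq_mean {β : Type*} (p : PMF β) (A : Set β) :
    p.toOuterMeasure A = mean p (A.indicator 1) := by
  rw [PMF.toOuterMeasure_apply, mean]
  refine tsum_congr fun b => ?_
  by_cases h : b ∈ A <;> simp [h]

theorem mean_uniformVertex_mem {n : ℕ} (hn : 0 < n) (P : Finset (Fin n)) :
    mean (uniformVertex n hn) (fun u => if u ∈ P then 1 else 0) = (n : ENNReal)⁻¹ * P.card := by
  have h (u : Fin n) : uniformVertex n hn u = (n : ENNReal)⁻¹ := by
    refine (PMF.uniformOfFinset_apply_of_mem ⟨⟨0, hn⟩, Finset.mem_univ _⟩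
      (Finset.mem_univ u)).trans ?_
    rw [Finset.card_univ, Fintype.card_fin]
  simp [mean, h, tsum_fintype, mul_comm]

end Expectation

/-! ### Expected number of hits and the limit -/

section ExpectedHits

variable {n s : ℕ}

/-- The number of rounds whose presented vertex was on level `k`, as long as no presented vertex
was on level `d`, and `0` afterwards. -/
noncomputable def stoppedHits (L d k : ℕ) (r : History n s) : ENNReal :=
  if hits (level L d) r = [] then (hits (level L k) r).length else 0

/-- The allowed increment does not depend on the player's answer, and the presented vertex lies in
`P` with conditional probability `P.card / n`. The reversal is needed because `historyLaw` appends
the latest round, while `hits` reads it first. -/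
theorem mean_historyLaw_succ_le (hn : 0 < n) (S : Strategy n s) (F : History n s → ENNReal)
    (A : History n s → Prop) [DecidablePred A] (P : History n s → Finset (Fin n))
    (hF : ∀ q r, F (q :: r) ≤ F r + if A r ∧ q.1 ∈ P r then 1 else 0) (t : ℕ) :
    mean (historyLaw hn S (t + 1)) (fun h => F h.reverse) ≤
      mean (historyLaw hn S t) (fun h => F h.reverse) +
        (n : ENNReal)⁻¹ *
          mean (historyLaw hn S t) fun h =>
            if A h.reverse then ((P h.reverse).card : ENNReal) else 0 := by
  rw [← mean_const_mul, ← mean_add, historyLaw, mean_bind]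
  refine mean_mono _ fun h => ?_
  rw [mean_bind]
  calc _ ≤ mean (uniformVertex n hn) fun u =>
        F h.reverse + (if A h.reverse then 1 else 0) * (if u ∈ P h.reverse then 1 else 0) := by
        refine mean_mono _ fun u => ?_
        rw [mean_map]
        refine (mean_mono _ fun B => ?_).trans (mean_const _ _).le
        rw [List.reverse_append]
        refine (hF (u, B) h.reverse).trans (le_of_eq ?_)
        by_cases h1 : A h.reverse <;> simp [h1]
    _ = _ := by
        rw [mean_add, mean_const, mean_const_mul, mean_uniformVertex_mem]
        by_cases h1 : A h.reverse <;> simp [h1]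

theorem stoppedHits_cons_le (L d k : ℕ) (q : Fin n × Choice n s) (r : History n s) :
    stoppedHits L d k (q :: r) ≤ stoppedHits L d k r +
      if hits (level L d) r = [] ∧ q.1 ∈ level L k r then 1 else 0 := by
  by_cases hr : hits (level L d) r = []
  · unfold stoppedHits
    split_ifs with h1 h2 h2 <;> simp_all [hits]
  · have : hits (level L d) (q :: r) ≠ [] := fun h =>
      hr (List.subset_nil.1 (h ▸ hits_subset_cons (level L d) q r))
    simp [stoppedHits, this]

/-- A functional growing only when a vertex on level `k` is presented while no presented vertex has
been on level `d` has expectation of order at most `t ^ (k + 1) / n ^ k`. -/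
theorem mean_historyLaw_le (hn : 0 < n) (S : Strategy n s) (L d k : ℕ) (F : History n s → ENNReal)
    (hnil : F [] = 0)
    (hF : ∀ q r, F (q :: r) ≤ F r +
      if hits (level L d) r = [] ∧ q.1 ∈ level L k r then 1 else 0) (t : ℕ) :
    mean (historyLaw hn S t) (fun h => F h.reverse) ≤
      ((n : ENNReal)⁻¹ * reachBound (d * (s - 1)) L) ^ k * (t : ENNReal) ^ (k + 1) := by
  induction k generalizing F t with
  | zero =>
    induction t with
    | zero => simp [historyLaw, mean_pure, hnil]
    | succ t ih =>
      refine (mean_historyLaw_succ_le hn S F _ _ hF t).trans ?_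
      simp only [pow_zero, zero_add, pow_one, one_mul, Nat.cast_add, Nat.cast_one] at ih ⊢
      refine add_le_add ih ?_
      calc _ ≤ (n : ENNReal)⁻¹ * mean (historyLaw hn S t) fun _ => (n : ENNReal) := by
            refine mul_le_mul_right (mean_mono _ fun h => ?_) _
            split_ifs <;> simp [level]
        _ ≤ 1 := by
            rw [mean_const]
            exact ENNReal.inv_mul_le_one _
  | succ k ihk =>
    induction t with
    | zero => simp [historyLaw, mean_pure, hnil]
    | succ t ih =>
      refine (mean_historyLaw_succ_le hn S F _ _ hF t).trans ?_
      set C : ENNReal := (reachBound (d * (s - 1)) L : ENNReal)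
      -- The stopped count for level `k` satisfies the hypothesis on `F` at `k`, and it controls the
      -- size of level `k + 1`.
      have hk := ihk (stoppedHits L d k) (by simp [stoppedHits, hits])
        (stoppedHits_cons_le L d k) t
      have hlev : (mean (historyLaw hn S t) fun h =>
          if hits (level L d) h.reverse = [] then ((level L (k + 1) h.reverse).card : ENNReal)
            else 0) ≤ C * mean (historyLaw hn S t) fun h => stoppedHits L d k h.reverse := by
        rw [← mean_const_mul]
        refine mean_mono _ fun h => ?_
        by_cases hh : hits (level L d) h.reverse = []
        · simp only [stoppedHits, hh, if_true, C]
          rw [mul_comm]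
          exact_mod_cast card_level_succ_le hh k
        · simp [hh]
      calc _ ≤ ((n : ENNReal)⁻¹ * C) ^ (k + 1) * (t : ENNReal) ^ (k + 1 + 1) +
            (n : ENNReal)⁻¹ * (C * (((n : ENNReal)⁻¹ * C) ^ k * (t : ENNReal) ^ (k + 1))) := by
            gcongr
            exact hlev.trans (by gcongr)
        _ = ((n : ENNReal)⁻¹ * C) ^ (k + 1) * ((t : ENNReal) ^ (k + 1) * (t + 1)) := by ring
        _ ≤ ((n : ENNReal)⁻¹ * C) ^ (k + 1) * (((t + 1 : ℕ) : ENNReal) ^ (k + 1) * (t + 1)) := by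
            gcongr; simp
        _ = _ := by push_cast; ring

theorem builtEdges_reverse (h : History n s) : builtEdges h.reverse = builtEdges h := by
  simp only [builtEdges, List.map_reverse, Multiset.coe_reverse]

theorem copyProb_le {α : Type*} {G : Hypergraph α} (hfin : G.vertexSet.Finite) {d : ℕ}
    (hdeg : degeneracy G = d + 1) (hn : 0 < n) (S : Strategy n s) (t : ℕ) :
    copyProb hn S G t ≤
      ((n : ENNReal)⁻¹ * reachBound (d * (s - 1)) G.vertexSet.ncard) ^ d *
        (t : ENNReal) ^ (d + 1) := by
  set L := G.vertexSet.ncard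
  rw [copyProb, hypergraphLaw, PMF.toOuterMeasure_map_apply, toOuterMeasure_eq_mean]
  -- The indicator of a hit on level `d` grows only at the first such hit, so the bound applies with
  -- `k = d`.
  refine le_trans (mean_mono _ fun h => ?_) (mean_historyLaw_le hn S L d d
    (fun r => if hits (level L d) r = [] then 0 else 1) (by simp [hits]) (fun q r => ?_) t)
  · by_cases hc : h ∈ builtEdges ⁻¹' {H | ContainsCopy G H}
    · rw [Set.indicator_of_mem hc, if_neg]
      · rfl
      · refine hits_ne_nil_of_containsCopy hfin hdeg ?_
        rw [builtEdges_reverse]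
        exact hc
    · rw [Set.indicator_of_notMem hc]
      exact zero_le
  · by_cases hr : hits (level L d) r = [] <;> by_cases hq : q.1 ∈ level L d r <;>
      simp [hits, hr, hq]

theorem tendsto_copyProb_bound {d : ℕ} (C : ℕ) (ω : ℕ → ℝ) (hω : Tendsto ω atTop atTop) :
    Tendsto (fun n : ℕ => ((n : ENNReal)⁻¹ * C) ^ d *
      ((⌊(n : ℝ) ^ ((((d + 1 : ℕ) : ℝ) - 1) / ((d + 1 : ℕ) : ℝ)) / ω n⌋₊ : ℕ) : ENNReal) ^ (d + 1))
      atTop (𝓝 0) := by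
  have hlim : Tendsto (fun n => ENNReal.ofReal ((C : ℝ) ^ d * ((ω n)⁻¹) ^ (d + 1)))
      atTop (𝓝 0) := by
    have h1 := ((tendsto_inv_atTop_zero.comp hω).pow (d + 1)).const_mul ((C : ℝ) ^ d)
    rw [zero_pow (Nat.succ_ne_zero d), mul_zero] at h1
    simpa using ENNReal.tendsto_ofReal h1
  refine tendsto_of_tendsto_of_tendsto_of_le_of_le' tendsto_const_nhds hlim
    (Eventually.of_forall fun _ => zero_le) ?_
  filter_upwards [hω.eventually_gt_atTop 0, eventually_gt_atTop 0] with n hpos hn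
  have hn' : (0 : ℝ) < n := by exact_mod_cast hn
  set x : ℝ := (n : ℝ) ^ ((((d + 1 : ℕ) : ℝ) - 1) / ((d + 1 : ℕ) : ℝ)) with hx
  -- This is where the exponent in `t` matters: the powers of `n` cancel exactly, leaving `C ^ d *
  -- (ω n)⁻¹ ^ (d + 1)`.
  have hxpow : x ^ (d + 1) = (n : ℝ) ^ d := by
    rw [hx, ← Real.rpow_natCast, ← Real.rpow_mul hn'.le, div_mul_cancel₀ _ (by positivity)]
    simp
  have hx0 : 0 ≤ x := by positivity
  have hfloor : (⌊x / ω n⌋₊ : ℝ) ≤ x / ω n := Nat.floor_le (by positivity)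
  have hleft : ((n : ENNReal)⁻¹ * C) ^ d * ((⌊x / ω n⌋₊ : ℕ) : ENNReal) ^ (d + 1) =
      ENNReal.ofReal (((n : ℝ)⁻¹ * C) ^ d * (⌊x / ω n⌋₊ : ℝ) ^ (d + 1)) := by
    rw [ENNReal.ofReal_mul (by positivity), ENNReal.ofReal_pow (by positivity),
      ENNReal.ofReal_pow (by positivity), ENNReal.ofReal_mul (by positivity),
      ENNReal.ofReal_inv_of_pos hn']
    simp
  rw [hleft]
  refine ENNReal.ofReal_le_ofReal ?_
  calc _ ≤ ((n : ℝ)⁻¹ * C) ^ d * (x / ω n) ^ (d + 1) := by gcongr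
    _ = _ := by
      have hcancel : ((n : ℝ)⁻¹) ^ d * (n : ℝ) ^ d = 1 := by
        rw [← mul_pow, inv_mul_cancel₀ hn'.ne', one_pow]
      rw [div_eq_mul_inv, mul_pow, mul_pow, hxpow]
      linear_combination (C : ℝ) ^ d * ((ω n)⁻¹) ^ (d + 1) * hcancel

end ExpectedHits

end SemiRandom

theorem mainTheorem3 {α : Type*} (s : ℕ) (hs : 2 ≤ s) (d : ℕ) (hd : 2 ≤ d)
    (G : Hypergraph α) (hfin : G.vertexSet.Finite) (hunif : SemiRandom.IsUniform G s)
    (hdeg : SemiRandom.degeneracy G = d)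
    (S : (n : Set.Ici (s - 1)) → SemiRandom.Strategy n s)
    (ω : ℕ → ℝ) (hω : Tendsto ω atTop atTop) :
    Tendsto
      (fun n : Set.Ici (s - 1) =>
        SemiRandom.copyProb (lt_of_lt_of_le (Nat.sub_pos_of_lt hs) n.2) (S n) G
          ⌊((n : ℕ) : ℝ) ^ (((d : ℝ) - 1) / (d : ℝ)) / ω n⌋₊)
      atTop (𝓝 0) := by
  obtain ⟨d, rfl⟩ : ∃ e, d = e + 1 := ⟨d - 1, by omega⟩
  have hbound := (tendsto_comp_val_Ici_atTop (a := s - 1)).2 (SemiRandom.tendsto_copyProb_bound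
    (d := d) (SemiRandom.reachBound (d * (s - 1)) G.vertexSet.ncard) ω hω)
  exact tendsto_of_tendsto_of_tendsto_of_le_of_le tendsto_const_nhds hbound
    (fun _ => zero_le) fun n => SemiRandom.copyProb_le hfin hdeg _ (S n) _
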